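/- Let $\Gamma$ be a (discrete) group and let $\Lambda\le\Gamma$ be a commensurated subgroup, i.e. $g\Lambda g^{-1}\cap\Lambda$ has finite index in both $\Lambda$ and $g\Lambda g^{-1}$ for every $g\in\Gamma$. Let $G=\Gamma/\!/\Lambda$ be the Schlichting completion of $\Gamma$ relative to $\Lambda$, i.e. the closure of the image of the homomorphism $\Gamma\to\operatorname{Sym}(\Gamma/\Lambda)$ given by left multiplication on $\Gamma/\Lambda$, where $\operatorname{Sym}(\Gamma/\Lambda)$ has the topology of pointwise convergence ($\Gamma/\Lambda$ being discrete). Then: 1. If $G$ is compactly generated and $\Lambda$ is finitely generated, then $\Gamma$ is finitely generated. 2. If $G$ is compactly presented and $\Lambda$ is finitely presented, then $\Gamma$ is finitely presented. 3. If $\Gamma$ is finitely generated, then $G$ is compactly generated. 4. If $\Gamma$ is finitely presented and $\Lambda$ is finitely generated, then $G$ is compactly presented. Here a topological group $G$ is compactly generated if it is generated, as an abstract group, by a compact subset, and compactly presented if, as an abstract group, it has a presentation $\langle K\mid R\rangle$ with $K\subseteq G$ a compact generating set and $R$ a set of relators of bounded word length in the letters $K^{\pm1}$. -/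

import Mathlib

/-- The topology of pointwise convergence on the symmetric group of a (discrete) set `X`,
i.e. the topology induced from the product topology on `X → X`, where `X` is discrete. -/
instance permPointwiseTopology (X : Type*) : TopologicalSpace (Equiv.Perm X) :=
  TopologicalSpace.induced (fun σ : Equiv.Perm X => (fun x => σ x : X → X))
    (@Pi.topologicalSpace X (fun _ => X) (fun _ => ⊥))

/-- Basic neighbourhoods: a map `f` into `Sym(X)` is continuous iff for all `x y` the set
of points `t` with `f t x = y` is open. -/
theorem continuous_perm_iff {X T : Type*} [TopologicalSpace T] (f : T → Equiv.Perm X) :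
    Continuous f ↔ ∀ x y : X, IsOpen {t : T | f t x = y} := by
  let _ : TopologicalSpace X := ⊥
  have _ : DiscreteTopology X := ⟨rfl⟩
  rw [continuous_induced_rng, continuous_pi_iff]
  refine forall_congr' fun x => ?_
  rw [continuous_discrete_rng]
  rfl

theorem isOpen_perm_apply_eq {X : Type*} (x y : X) :
    IsOpen {σ : Equiv.Perm X | σ x = y} :=
  (continuous_perm_iff (fun σ : Equiv.Perm X => σ)).1 continuous_id x y

instance permPointwise_isTopologicalGroup (X : Type*) : IsTopologicalGroup (Equiv.Perm X) where
  continuous_mul := by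
    rw [continuous_perm_iff]
    intro x y
    have h : {p : Equiv.Perm X × Equiv.Perm X | (p.1 * p.2) x = y} =
        ⋃ z : X, {σ : Equiv.Perm X | σ z = y} ×ˢ {σ : Equiv.Perm X | σ x = z} := by
      ext p
      simp
    rw [h]
    exact isOpen_iUnion fun z => (isOpen_perm_apply_eq z y).prod (isOpen_perm_apply_eq x z)
  continuous_inv := by
    rw [continuous_perm_iff]
    intro x y
    have h : {σ : Equiv.Perm X | σ⁻¹ x = y} = {σ : Equiv.Perm X | σ y = x} := by
      ext σ
      simp only [Set.mem_ofPred_eq, Equiv.Perm.inv_eq_iff_eq]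
      exact eq_comm
    rw [h]
    exact isOpen_perm_apply_eq y x

/-- The subgroup `Λ` of `Γ` is commensurated: for every `g` in `Γ`, the subgroups
`g Λ g⁻¹` and `Λ` are commensurable. -/
def Subgroup.IsCommensurated {Γ : Type*} [Group Γ] (Λ : Subgroup Γ) : Prop :=
  Subgroup.Commensurable.commensurator Λ = ⊤

/-- The Schlichting completion `Γ//Λ`: the closure in `Sym(Γ/Λ)` (with the topology of pointwise
convergence) of the image of `Γ` under the action by left multiplication on `Γ/Λ`.
It carries the subspace topology. -/
def schlichtingCompletion {Γ : Type*} [Group Γ] (Λ : Subgroup Γ) :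
    Subgroup (Equiv.Perm (Γ ⧸ Λ)) :=
  (MulAction.toPermHom Γ (Γ ⧸ Λ)).range.topologicalClosure

/-- A topological group is compactly generated if it is generated, as an abstract group, by
a compact subset. -/
def IsCompactlyGeneratedGroup (G : Type*) [Group G] [TopologicalSpace G] : Prop :=
  ∃ K : Set G, IsCompact K ∧ Subgroup.closure K = ⊤

/-- A topological group is compactly presented if, as an abstract group, it has a presentation
`⟨K ∣ R⟩` with `K` a compact subset of `G` and `R` a set of relators of bounded word length. -/
def IsCompactlyPresentedGroup (G : Type*) [Group G] [TopologicalSpace G] : Prop :=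
  ∃ K : Set G, IsCompact K ∧ Subgroup.closure K = ⊤ ∧
    ∃ (n : ℕ) (R : Set (FreeGroup K)),
      (∀ r ∈ R, ∃ w : List (K × Bool), w.length ≤ n ∧ FreeGroup.mk w = r) ∧
      Subgroup.normalClosure R = (FreeGroup.lift (fun k : K => (k : G))).ker

/-! Write `G` for the completion, `o` for the base coset and `U` for the stabiliser of `o` in `G`.
Commensuration makes the `Λ`-orbits on `Γ ⧸ Λ` finite, so `U` is a compact open subgroup. By density
`G` is the image of `Γ` times `U`, and `Λ` is the preimage of `U`. For a finite set `Y` of cosets,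
the `g` with `g • o ∈ Y` (`translators`) form a compact set in `G` and a finite union of left cosets
of `Λ` in `Γ`. Generation and presentation are compared through these sets.

For generation, the translators of `Y` generate `Γ` if they generate `G`, and adding `U` to
generators of `Γ` generates `G`.

For presentations, the condition transported is that the triangles `a * b = c` inside the
translators present the group, that is, `toAmbient` is bijective. Relators of bounded length give it
for a large ball thickened on both sides by the stabiliser, once the ball contains generators of the
stabiliser (`toAmbient_bijective_of_presentation`). For `Λ` this is finite generation, for `U` a
Baire argument. The condition passes from `Γ` to `G` by a normal form
(`toAmbient_translators_bijective_of_dense`), and from `G` to `Γ` by letting `G` act, through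
approximation by `Γ`, on the cosets of a copy of `Λ` in the local group of `Γ`
(`toAmbient_translators_bijective_of_dense'`).

In `G` the triangles are relators of length 3 over a compact set. In `Γ` they reduce to finitely
many relators over the free product of `Λ` and the free group on `Y`
(`Group.IsFinitelyPresented.of_toAmbient_translators_bijective`). -/

open Pointwise

/-! ### Groups presented by the triangles of a subset. -/

/-- The relators `a * b * c⁻¹` for all `a b c` in `A` with `a * b = c`. -/
def triangleRelators {H : Type*} [Group H] (A : Set H) : Set (FreeGroup A) :=
  {r | ∃ a b c : A, (a : H) * b = c ∧
    r = FreeGroup.of a * FreeGroup.of b * (FreeGroup.of c)⁻¹}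

/-- The group generated by `A`, with the relations `a * b = c` that hold in `A`. -/
abbrev LocalGroup {H : Type*} [Group H] (A : Set H) : Type _ :=
  PresentedGroup (triangleRelators A)

namespace LocalGroup

variable {H : Type*} [Group H] {A : Set H}

open Classical in
/-- The generator of `LocalGroup A` given by `h` (which is `1` when `h ∉ A`). -/
noncomputable def of (A : Set H) (h : H) : LocalGroup A :=
  if hh : h ∈ A then PresentedGroup.of ⟨h, hh⟩ else 1

theorem of_mem {h : H} (hh : h ∈ A) : of A h = PresentedGroup.of ⟨h, hh⟩ := dif_pos hh

theorem of_mul {a b : H} (ha : a ∈ A) (hb : b ∈ A) (hab : a * b ∈ A) :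
    of A (a * b) = of A a * of A b := by
  rw [of_mem ha, of_mem hb, of_mem hab]
  have h := PresentedGroup.one_of_mem (rels := triangleRelators A)
    (x := FreeGroup.of ⟨a, ha⟩ * FreeGroup.of ⟨b, hb⟩ * (FreeGroup.of ⟨a * b, hab⟩)⁻¹)
    ⟨⟨a, ha⟩, ⟨b, hb⟩, ⟨a * b, hab⟩, rfl, rfl⟩
  rw [map_mul, map_mul, map_inv] at h
  exact (mul_inv_eq_one.1 h).symm

theorem of_one (h1 : (1 : H) ∈ A) : of A 1 = 1 := by
  have h := of_mul h1 h1 (by simpa using h1)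
  simpa using h

theorem of_inv (h1 : (1 : H) ∈ A) {a : H} (ha : a ∈ A) (ha' : a⁻¹ ∈ A) :
    of A a⁻¹ = (of A a)⁻¹ := by
  have h := of_mul ha ha' (by simpa using h1)
  rw [mul_inv_cancel, of_one h1] at h
  exact eq_inv_of_mul_eq_one_right h.symm

/-- The homomorphism out of `LocalGroup A` given by a map that is multiplicative in `A`. -/
def lift {P : Type*} [Group P] (f : H → P)
    (hf : ∀ a ∈ A, ∀ b ∈ A, a * b ∈ A → f (a * b) = f a * f b) : LocalGroup A →* P :=
  PresentedGroup.toGroup (f := fun a : A => f a) (by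
    rintro r ⟨a, b, c, h, rfl⟩
    have := hf a a.2 b b.2 (h ▸ c.2)
    rw [h] at this
    simp [this])

theorem lift_of {P : Type*} [Group P] {f : H → P}
    {hf : ∀ a ∈ A, ∀ b ∈ A, a * b ∈ A → f (a * b) = f a * f b} {a : H} (ha : a ∈ A) :
    lift f hf (of A a) = f a := by
  rw [of_mem ha]
  exact PresentedGroup.toGroup.of _

/-- The canonical homomorphism from `LocalGroup A` to the ambient group. -/
def toAmbient (A : Set H) : LocalGroup A →* H := lift (fun h => h) fun _ _ _ _ _ => rfl

theorem toAmbient_of {a : H} (ha : a ∈ A) : toAmbient A (of A a) = a := lift_of ha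

theorem closure_of (A : Set H) : Subgroup.closure (of A '' A) = ⊤ := by
  rw [← top_le_iff, ← PresentedGroup.closure_range_of, Subgroup.closure_le]
  rintro _ ⟨a, rfl⟩
  exact Subgroup.subset_closure ⟨a, a.2, of_mem a.2⟩

theorem hom_ext {P : Type*} [Group P] {f g : LocalGroup A →* P}
    (h : ∀ a ∈ A, f (of A a) = g (of A a)) : f = g := by
  refine MonoidHom.eq_of_eqOn_dense (closure_of A) ?_
  rintro _ ⟨a, ha, rfl⟩
  exact h a ha

theorem range_toAmbient (A : Set H) : (toAmbient A).range = Subgroup.closure A := by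
  rw [MonoidHom.range_eq_map, ← closure_of, MonoidHom.map_closure, ← Set.image_comp]
  congr 1
  ext h
  constructor
  · rintro ⟨a, ha, rfl⟩
    simpa [toAmbient_of ha] using ha
  · exact fun hh => ⟨h, hh, toAmbient_of hh⟩

theorem toAmbient_surjective_iff :
    Function.Surjective (toAmbient A) ↔ Subgroup.closure A = ⊤ := by
  rw [← range_toAmbient, MonoidHom.range_eq_top]

/-- Left induction over `LocalGroup A` for symmetric `A`. -/
theorem induction_left (h1 : (1 : H) ∈ A) (hA : ∀ a ∈ A, a⁻¹ ∈ A) {p : LocalGroup A → Prop}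
    (one : p 1) (mul : ∀ a ∈ A, ∀ x, p x → p (of A a * x)) (x : LocalGroup A) : p x := by
  have hx : x ∈ Subgroup.closure (of A '' A) := by rw [closure_of]; trivial
  induction hx using Subgroup.closure_induction_left with
  | one => exact one
  | mul_left y hy z hz ih =>
    obtain ⟨a, ha, rfl⟩ := hy
    exact mul a ha _ ih
  | inv_mul_cancel y hy z hz ih =>
    obtain ⟨a, ha, rfl⟩ := hy
    rw [← of_inv h1 ha (hA a ha)]
    exact mul _ (hA a ha) _ ih

/-- Right induction over `LocalGroup A` for symmetric `A`. -/
theorem induction_right (h1 : (1 : H) ∈ A) (hA : ∀ a ∈ A, a⁻¹ ∈ A) {p : LocalGroup A → Prop}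
    (one : p 1) (mul : ∀ a ∈ A, ∀ x, p x → p (x * of A a)) (x : LocalGroup A) : p x := by
  have hx : x ∈ Subgroup.closure (of A '' A) := by rw [closure_of]; trivial
  induction hx using Subgroup.closure_induction_right with
  | one => exact one
  | mul_right y hy z hz ih =>
    obtain ⟨a, ha, rfl⟩ := hz
    exact mul a ha _ ih
  | mul_inv_cancel y hy z hz ih =>
    obtain ⟨a, ha, rfl⟩ := hz
    rw [← of_inv h1 ha (hA a ha)]
    exact mul _ (hA a ha) _ ih

end LocalGroup

/-! ### Word balls. -/

/-- The letters of words in `f i` and their inverses, together with `1`. -/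
def letters {I H : Type*} [Group H] (f : I → H) : Set H :=
  Set.range f ∪ (Set.range f)⁻¹ ∪ {1}

section Letters

variable {I H : Type*} [Group H] (f : I → H)

theorem one_mem_letters : (1 : H) ∈ letters f := Or.inr rfl

theorem mem_letters (i : I) : f i ∈ letters f := Or.inl (Or.inl ⟨i, rfl⟩)

theorem inv_mem_letters (i : I) : (f i)⁻¹ ∈ letters f := Or.inl (Or.inr ⟨i, by simp⟩)

theorem letters_inv : (letters f)⁻¹ = letters f := by
  simp [letters, Set.union_comm]

theorem letters_pow_inv (n : ℕ) : (letters f ^ n)⁻¹ = letters f ^ n := by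
  induction n with
  | zero => simp
  | succ n ih => rw [pow_succ, mul_inv_rev, ih, letters_inv, ← pow_succ', pow_succ]

theorem letters_pow_mono {m n : ℕ} (h : m ≤ n) : letters f ^ m ⊆ letters f ^ n :=
  Set.pow_subset_pow_right (one_mem_letters f) h

theorem one_mem_letters_pow (n : ℕ) : (1 : H) ∈ letters f ^ n :=
  Set.one_mem_pow (one_mem_letters f)

theorem exists_mem_letters_pow (hf : Subgroup.closure (Set.range f) = ⊤) (h : H) :
    ∃ n, h ∈ letters f ^ n := by
  have hh : h ∈ Subgroup.closure (Set.range f) := by rw [hf]; trivial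
  induction hh using Subgroup.closure_induction_left with
  | one => exact ⟨0, by simp⟩
  | mul_left y hy z hz ih =>
    obtain ⟨n, hn⟩ := ih
    exact ⟨n + 1, pow_succ' (letters f) n ▸ Set.mul_mem_mul (Or.inl (Or.inl hy)) hn⟩
  | inv_mul_cancel y hy z hz ih =>
    obtain ⟨n, hn⟩ := ih
    exact ⟨n + 1, pow_succ' (letters f) n ▸ Set.mul_mem_mul (Or.inl (Or.inr (by simpa using hy))) hn⟩

theorem lift_mk_mem_letters_pow (w : List (I × Bool)) :
    FreeGroup.lift f (FreeGroup.mk w) ∈ letters f ^ w.length := by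
  induction w with
  | nil => simp
  | cons a w ih =>
    rw [List.length_cons, pow_succ', FreeGroup.lift_mk, List.map_cons, List.prod_cons,
      ← FreeGroup.lift_mk]
    refine Set.mul_mem_mul ?_ ih
    rcases a with ⟨i, _ | _⟩
    · exact inv_mem_letters f i
    · exact mem_letters f i

end Letters

/-! ### From relators of bounded length to triangles. -/

section BoundedPresentation

variable {I H : Type*} [Group H] (f : I → H) (L : Subgroup H) {A : Set H} {N : ℕ}

open LocalGroup

/-- All suffixes of `w` have values in the ball, hence in `A`, so triangles evaluate the word one
letter at a time. A relator of length at most `N` thus dies in the local group. -/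
theorem lift_of_mk (hN : letters f ^ N ⊆ A)
    (w : List (I × Bool)) (hw : w.length ≤ N) :
    FreeGroup.lift (fun i => of A (f i)) (FreeGroup.mk w) =
      of A (FreeGroup.lift f (FreeGroup.mk w)) := by
  have h1 : (1 : H) ∈ A := hN (one_mem_letters_pow f N)
  induction w with
  | nil => simpa using (of_one h1).symm
  | cons a w ih =>
    rw [List.length_cons] at hw
    have hA : ∀ x ∈ letters f, x ∈ A := fun x hx =>
      hN (letters_pow_mono f (show 1 ≤ N by omega) (by simpa using hx))
    have hl := letters_pow_mono f hw (pow_succ' (letters f) w.length ▸ Set.mul_mem_mul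
      (show (if a.2 then f a.1 else (f a.1)⁻¹) ∈ letters f by
        split_ifs
        · exact mem_letters f _
        · exact inv_mem_letters f _) (lift_mk_mem_letters_pow f w))
    have hw' := hN (letters_pow_mono f (show w.length ≤ N by omega) (lift_mk_mem_letters_pow f w))
    have key := ih (by omega)
    rw [FreeGroup.lift_mk, FreeGroup.lift_mk, List.map_cons, List.map_cons, List.prod_cons,
      List.prod_cons, ← FreeGroup.lift_mk,
      ← FreeGroup.lift_mk (f := fun i => of A (f i)), key]
    rcases a with ⟨i, _ | _⟩
    · simp only [cond_false]
      rw [of_mul (hA _ (inv_mem_letters f i)) hw' (hN (by simpa using hl)),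
        of_inv h1 (hA _ (mem_letters f i)) (hA _ (inv_mem_letters f i))]
    · simp only [cond_true]
      rw [of_mul (hA _ (mem_letters f i)) hw' (hN (by simpa using hl))]

/-- If a group has a presentation with relators of bounded length, then a large enough ball,
thickened by a subgroup `L` that it generates, presents the group by its triangles. -/
theorem toAmbient_bijective_of_presentation
    (hf : Subgroup.closure (Set.range f) = ⊤) (R : Set (FreeGroup I))
    (hR : ∀ r ∈ R, ∃ w : List (I × Bool), w.length ≤ N ∧ FreeGroup.mk w = r)
    (hker : Subgroup.normalClosure R = (FreeGroup.lift f).ker)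
    (h1N : 1 ≤ N) (hL : L ≤ Subgroup.closure (L ∩ letters f ^ N))
    (hA : A = L * letters f ^ N * L) : Function.Bijective (toAmbient A) := by
  have hNA : letters f ^ N ⊆ A := fun x hx => by
    rw [hA]
    exact ⟨x, ⟨1, L.one_mem, x, hx, by simp⟩, 1, L.one_mem, by simp⟩
  have hLA : ∀ l ∈ L, l ∈ A := fun l hl => by
    rw [hA]
    exact ⟨l, ⟨l, hl, 1, one_mem_letters_pow f N, by simp⟩, 1, L.one_mem, by simp⟩
  have h1 : (1 : H) ∈ A := hNA (one_mem_letters_pow f N)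
  have hlA : ∀ x ∈ letters f, x ∈ A := fun x hx =>
      hNA (letters_pow_mono f h1N (by simpa using hx))
  have hsurj : Function.Surjective (FreeGroup.lift f) := by
    rw [← MonoidHom.range_eq_top, FreeGroup.range_lift_eq_closure, hf]
  have hle : (FreeGroup.lift f).ker ≤ (FreeGroup.lift fun i => of A (f i)).ker := by
    rw [← hker]
    refine Subgroup.normalClosure_le_normal fun r hr => ?_
    obtain ⟨w, hw, rfl⟩ := hR r hr
    have h0 : FreeGroup.lift f (FreeGroup.mk w) = 1 := by
      rw [← MonoidHom.mem_ker, ← hker]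
      exact Subgroup.subset_normalClosure hr
    change FreeGroup.lift _ _ = 1
    rw [lift_of_mk f hNA w hw, h0, of_one h1]
  -- The relators die in the local group, so sending `f i` to its generator descends to `H`. This
  -- `s` will be a left inverse of `toAmbient A`.
  let s : H →* LocalGroup A := (FreeGroup.lift f).liftOfSurjective hsurj ⟨_, hle⟩
  have hs : ∀ x, s (FreeGroup.lift f x) = FreeGroup.lift (fun i => of A (f i)) x := fun x =>
    MonoidHom.liftOfRightInverse_comp_apply _ _ _ _ _
  have hs1 : ∀ x ∈ letters f, s x = of A x := by
    have hgen : ∀ i, s (f i) = of A (f i) := fun i => by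
      simpa using hs (FreeGroup.of i)
    rintro x ((⟨i, rfl⟩ | ⟨i, hi⟩) | rfl)
    · exact hgen i
    · rw [← inv_eq_iff_eq_inv] at hi
      subst hi
      rw [map_inv, hgen, of_inv h1 (hlA _ (mem_letters f i)) (hlA _ (inv_mem_letters f i))]
    · rw [map_one, of_one h1]
  have hspow : ∀ n ≤ N, ∀ x ∈ letters f ^ n, s x = of A x := by
    intro n
    induction n with
    | zero =>
      intro _ x hx
      rw [pow_zero, Set.mem_one] at hx
      rw [hx, map_one, of_one h1]
    | succ n ih =>
      intro hn x hx
      have hx' := hx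
      rw [pow_succ'] at hx
      obtain ⟨a, ha, y, hy, rfl⟩ := hx
      dsimp only at hx' ⊢
      rw [map_mul, hs1 a ha, ih (by omega) y hy, of_mul (hlA a ha)
        (hNA (letters_pow_mono f (by omega) hy)) (hNA (letters_pow_mono f hn hx'))]
  -- Since `L` is a subgroup inside `A`, `of A` is a homomorphism on it; it agrees with `s` on the
  -- generators of `L` lying in the ball.
  have hsL : ∀ l ∈ L, s l = of A l := by
    let ρ : L →* LocalGroup A :=
      { toFun := fun l => of A l
        map_one' := of_one h1
        map_mul' := fun a b => of_mul (hLA a a.2) (hLA b b.2) (hLA _ (a * b).2) }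
    intro l hl
    have hmem := hL hl
    suffices ∀ x ∈ Subgroup.closure ((L : Set H) ∩ letters f ^ N),
        ∃ hx : x ∈ L, s x = ρ ⟨x, hx⟩ from (this l hmem).2
    intro x hx
    induction hx using Subgroup.closure_induction with
    | mem x hx => exact ⟨hx.1, hspow N le_rfl x hx.2⟩
    | one => exact ⟨L.one_mem, by rw [map_one]; exact (map_one ρ).symm⟩
    | mul x y _ _ hx hy =>
      obtain ⟨hx, hx'⟩ := hx
      obtain ⟨hy, hy'⟩ := hy
      exact ⟨L.mul_mem hx hy, by rw [map_mul, hx', hy', ← map_mul]; rfl⟩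
    | inv x _ hx =>
      obtain ⟨hx, hx'⟩ := hx
      exact ⟨L.inv_mem hx, by rw [map_inv, hx', ← map_inv]; rfl⟩
  have hsA : s.comp (toAmbient A) = MonoidHom.id _ := by
    refine hom_ext fun a ha => ?_
    rw [MonoidHom.comp_apply, toAmbient_of ha, MonoidHom.id_apply]
    have ha' := ha
    rw [hA] at ha
    obtain ⟨_, ⟨l, hl, x, hx, rfl⟩, l', hl', rfl⟩ := ha
    dsimp only at ha' ⊢
    have hlx : l * x ∈ A := by
      rw [hA]
      exact ⟨l * x, ⟨l, hl, x, hx, rfl⟩, 1, L.one_mem, by simp⟩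
    rw [of_mul hlx (hLA l' hl') ha', of_mul (hLA l hl) (hNA hx) hlx, map_mul, map_mul,
      hsL l hl, hsL l' hl', hspow N le_rfl x hx]
  refine ⟨fun x y hxy => ?_, ?_⟩
  · rw [← MonoidHom.id_apply _ x, ← MonoidHom.id_apply _ y, ← hsA, MonoidHom.comp_apply,
      MonoidHom.comp_apply, hxy]
  · rw [toAmbient_surjective_iff, ← top_le_iff, ← hf]
    refine Subgroup.closure_mono ?_
    rintro _ ⟨i, rfl⟩
    exact hlA _ (mem_letters f i)

end BoundedPresentation

/-! ### Transport between a group and a dense image. -/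

/-- The elements of `G` that move the base point `o` into `Y`. -/
def translators (G : Type*) {X : Type*} [Group G] [MulAction G X] (o : X) (Y : Set X) : Set G :=
  {g | g • o ∈ Y}

section DenseAction

open LocalGroup

variable {Γ G X : Type*} [Group Γ] [Group G] [MulAction Γ X] [MulAction G X]
  (φ : Γ →* G) (hφ : ∀ (γ : Γ) (x : X), φ γ • x = γ • x)
  (hd : ∀ (g : G) (F : Finset X), ∃ γ : Γ, ∀ x ∈ F, γ • x = g • x)
  {o : X} {Y : Set X}

include hφ in
theorem map_mem_translators_iff {γ : Γ} : φ γ ∈ translators G o Y ↔ γ ∈ translators Γ o Y := by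
  simp [translators, hφ]

include hφ in
theorem translators_inv_mem_of_dense
    (hV : ∀ v ∈ translators G o Y, v⁻¹ ∈ translators G o Y) :
    ∀ w ∈ translators Γ o Y, w⁻¹ ∈ translators Γ o Y := fun w hw => by
  rw [← map_mem_translators_iff φ hφ] at hw ⊢
  rw [map_inv]
  exact hV _ hw

-- Symmetry passes up because an element of `Γ` agreeing with `v` on both `o` and `v⁻¹ • o` has the
-- same translate of `o` as `v`, and so does its inverse.
include hd in
theorem translators_inv_mem_of_dense'
    (hW : ∀ w ∈ translators Γ o Y, w⁻¹ ∈ translators Γ o Y) :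
    ∀ v ∈ translators G o Y, v⁻¹ ∈ translators G o Y := fun v hv => by
  classical
  obtain ⟨w, hw⟩ := hd v {o, v⁻¹ • o}
  have h1 : w • o = v • o := hw _ (by simp)
  have h2 : w • v⁻¹ • o = o := by simpa using hw (v⁻¹ • o) (by simp)
  have h3 : w⁻¹ • o = v⁻¹ • o := by rw [inv_smul_eq_iff, h2]
  have h4 := hW w (show w • o ∈ Y by rw [h1]; exact hv)
  change v⁻¹ • o ∈ Y
  rw [← h3]
  exact h4

include hφ hd in
/-- Every `g` is a product of an element of the image of `Γ` and an element fixing `o`. -/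
theorem exists_mul_of_dense (g : G) : ∃ (γ : Γ) (u : G), u • o = o ∧ g = φ γ * u ∧ γ • o = g • o := by
  obtain ⟨γ, hγ⟩ := hd g {o}
  have h : γ • o = g • o := hγ o (by simp)
  refine ⟨γ, (φ γ)⁻¹ * g, ?_, by simp, h⟩
  rw [mul_smul, ← h, ← hφ, inv_smul_smul]

include hφ hd in
theorem closure_translators_eq_top_of_dense (ho : o ∈ Y)
    (hW : Subgroup.closure (translators Γ o Y) = ⊤) :
    Subgroup.closure (translators G o Y) = ⊤ := by
  rw [eq_top_iff]
  intro g _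
  obtain ⟨γ, u, hu, rfl, -⟩ := exists_mul_of_dense (o := o) φ hφ hd g
  refine Subgroup.mul_mem _ ?_ (Subgroup.subset_closure (show u • o ∈ Y by rwa [hu]))
  have h : γ ∈ (Subgroup.closure (translators G o Y)).comap φ := by
    have h' : γ ∈ Subgroup.closure (translators Γ o Y) := by rw [hW]; trivial
    refine (Subgroup.closure_le _).2 ?_ h'
    exact fun w hw => Subgroup.subset_closure ((map_mem_translators_iff φ hφ).2 hw)
  exact h

-- The subgroup generated by the translators contains the stabiliser of `o`, so it suffices that its
-- orbit of `o` is the whole `G`-orbit. This is shown by induction on words in `G`.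
include hφ hd in
theorem closure_translators_eq_top_of_dense' (ho : o ∈ Y)
    (hV : ∀ v ∈ translators G o Y, v⁻¹ ∈ translators G o Y)
    (hVtop : Subgroup.closure (translators G o Y) = ⊤) :
    Subgroup.closure (translators Γ o Y) = ⊤ := by
  classical
  have hstab : ∀ γ : Γ, γ • o = o → γ ∈ Subgroup.closure (translators Γ o Y) := fun γ h =>
    Subgroup.subset_closure (show γ • o ∈ Y by rwa [h])
  have key : ∀ g : G, ∃ γ ∈ Subgroup.closure (translators Γ o Y), γ • o = g • o := by
    intro g
    have hg : g ∈ Subgroup.closure (translators G o Y) := by rw [hVtop]; trivial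
    have step : ∀ x : G, (∃ γ ∈ Subgroup.closure (translators Γ o Y), γ • o = x • o) →
        ∀ v ∈ translators G o Y,
          ∃ γ ∈ Subgroup.closure (translators Γ o Y), γ • o = (x * v) • o := by
      rintro x ⟨γ, hγ, hx⟩ v hv
      obtain ⟨w, hw⟩ := hd ((φ γ)⁻¹ * (x * v)) {o}
      have hw := hw o (by simp)
      -- This `u` fixes `o` and carries `v • o` to `w • o`, so `w = u * (u⁻¹ * w)` is a stabiliser
      -- element times a translator.
      obtain ⟨u, hu⟩ := hd ((φ γ)⁻¹ * x) {o, v • o}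
      have hu1 : u • o = o := by
        rw [hu o (by simp), mul_smul, ← hx, ← hφ, inv_smul_smul]
      have hu2 : w • o = u • v • o := by
        rw [hw, hu _ (by simp), ← mul_smul, mul_assoc]
      have hw' : w ∈ Subgroup.closure (translators Γ o Y) := by
        have : u⁻¹ * w ∈ Subgroup.closure (translators Γ o Y) :=
          Subgroup.subset_closure (show (u⁻¹ * w) • o ∈ Y by
            rw [mul_smul, hu2, inv_smul_smul]; exact hv)
        have := Subgroup.mul_mem _ (hstab u hu1) this
        rwa [mul_inv_cancel_left] at this
      refine ⟨γ * w, Subgroup.mul_mem _ hγ hw', ?_⟩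
      rw [mul_smul, hw, ← hφ, ← mul_smul, mul_inv_cancel_left]
    induction hg using Subgroup.closure_induction_right with
    | one => exact ⟨1, Subgroup.one_mem _, by simp⟩
    | mul_right x _ v hv ih => exact step x ih v hv
    | mul_inv_cancel x _ v hv ih => exact step x ih _ (hV v hv)
  rw [eq_top_iff]
  intro γ _
  obtain ⟨δ, hδ, h⟩ := key (φ γ)
  rw [hφ] at h
  have := Subgroup.mul_mem _ hδ (hstab (δ⁻¹ * γ) (by rw [mul_smul, ← h, inv_smul_smul]))
  rwa [mul_inv_cancel_left] at this

include hφ hd in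
/-- Triangular presentations pass from a group to a group in which it is dense. -/
theorem toAmbient_translators_bijective_of_dense (ho : o ∈ Y)
    (hW : ∀ w ∈ translators Γ o Y, w⁻¹ ∈ translators Γ o Y)
    (h : Function.Bijective (toAmbient (translators Γ o Y))) :
    Function.Bijective (toAmbient (translators G o Y)) := by
  have hV := translators_inv_mem_of_dense' hd hW
  have h1V : (1 : G) ∈ translators G o Y := show (1 : G) • o ∈ Y by rwa [one_smul]
  have hUV : ∀ u : G, u • o = o → u ∈ translators G o Y := fun u hu =>
    show u • o ∈ Y by rwa [hu]
  let e := (MulEquiv.ofBijective _ h).symm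
  have he : ∀ w ∈ translators Γ o Y, e w = of _ w := fun w hw => by
    rw [MulEquiv.symm_apply_eq]
    exact (toAmbient_of hw).symm
  let κ : LocalGroup (translators Γ o Y) →* LocalGroup (translators G o Y) :=
    lift (fun w : Γ => of (translators G o Y) (φ w)) fun a ha b hb hab => by
      rw [map_mul]
      rw [← map_mem_translators_iff φ hφ] at ha hb hab
      exact of_mul ha hb (by rwa [← map_mul])
  let ψ : Γ →* LocalGroup (translators G o Y) := κ.comp e.toMonoidHom
  have hψ : ∀ w ∈ translators Γ o Y, ψ w = of _ (φ w) := fun w hw => by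
    change κ (e w) = _
    rw [he w hw]
    exact lift_of hw
  have hψφ : ∀ γ, toAmbient (translators G o Y) (ψ γ) = φ γ := fun γ => by
    have : ((toAmbient (translators G o Y)).comp ψ).comp (toAmbient (translators Γ o Y)) =
        φ.comp (toAmbient (translators Γ o Y)) := hom_ext fun w hw => by
      simp only [MonoidHom.comp_apply]
      rw [toAmbient_of hw, hψ w hw, toAmbient_of ((map_mem_translators_iff φ hφ).2 hw)]
    obtain ⟨x, rfl⟩ := h.2 γ
    exact DFunLike.congr_fun this x
  -- Normal form: multiplying by a further `v` preserves it, because `u * v` is again a translator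
  -- and splits by density into a part from `Γ` and a part fixing `o`.
  have hdec : ∀ x : LocalGroup (translators G o Y),
      ∃ (γ : Γ) (u : G), u • o = o ∧ x = ψ γ * of _ u := by
    refine induction_right h1V hV ⟨1, 1, one_smul _ _, by rw [map_one, of_one h1V, mul_one]⟩ ?_
    rintro v hv _ ⟨γ, u, hu, rfl⟩
    have huv' : u * v ∈ translators G o Y := by
      have h1 : v⁻¹ * u⁻¹ ∈ translators G o Y := by
        change (v⁻¹ * u⁻¹) • o ∈ Y
        rw [mul_smul, inv_smul_eq_iff.2 hu.symm]
        exact hV _ hv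
      simpa using hV _ h1
    obtain ⟨w, u', hu', huvw, hwo⟩ := exists_mul_of_dense (o := o) φ hφ hd (u * v)
    have hw : w ∈ translators Γ o Y := by
      change w • o ∈ Y
      rw [hwo]
      exact huv'
    refine ⟨γ * w, u', hu', ?_⟩
    rw [mul_assoc, ← of_mul (hUV u hu) hv huv', huvw, of_mul ((map_mem_translators_iff φ hφ).2 hw)
      (hUV u' hu') (huvw ▸ huv'), map_mul, hψ w hw, mul_assoc]
  refine ⟨(injective_iff_map_eq_one _).2 fun x hx => ?_, ?_⟩
  · obtain ⟨γ, u, hu, rfl⟩ := hdec x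
    rw [map_mul, hψφ, toAmbient_of (hUV u hu)] at hx
    -- A kernel element forces `γ` to fix `o`, so `ψ γ` is a single generator and cancels against
    -- `of _ u`.
    have hγ : φ γ = u⁻¹ := eq_inv_of_mul_eq_one_left hx
    have hγo : γ • o = o := by rw [← hφ, hγ, inv_smul_eq_iff, hu]
    rw [hψ γ (show γ • o ∈ Y by rwa [hγo]), hγ, of_inv h1V (hUV u hu) (hV _ (hUV u hu)),
      inv_mul_cancel]
  · rw [toAmbient_surjective_iff] at *
    exact closure_translators_eq_top_of_dense φ hφ hd ho (toAmbient_surjective_iff.1 h.2)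

/-- The subgroup of the local group given by the stabiliser of the base point. -/
def localStabilizer (ho : o ∈ Y) : Subgroup (LocalGroup (translators Γ o Y)) where
  carrier := {x | ∃ l : Γ, l • o = o ∧ x = of _ l}
  one_mem' := ⟨1, one_smul _ _, (of_one (show (1 : Γ) • o ∈ Y by rwa [one_smul])).symm⟩
  mul_mem' := by
    rintro _ _ ⟨a, ha, rfl⟩ ⟨b, hb, rfl⟩
    have hab : (a * b) • o = o := by rw [mul_smul, hb, ha]
    exact ⟨a * b, hab, (of_mul (A := translators Γ o Y) (show a • o ∈ Y by rwa [ha]) (show b • o ∈ Y by rwa [hb])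
      (show (a * b) • o ∈ Y by rwa [hab])).symm⟩
  inv_mem' := by
    rintro _ ⟨a, ha, rfl⟩
    have ha' : a⁻¹ • o = o := by rw [inv_smul_eq_iff, ha]
    exact ⟨a⁻¹, ha', (of_inv (A := translators Γ o Y) (show (1 : Γ) • o ∈ Y by rwa [one_smul])
      (show a • o ∈ Y by rwa [ha]) (show a⁻¹ • o ∈ Y by rwa [ha'])).symm⟩

/-- Continuity of the local group's action on cosets: a generator moves `p` in a way that depends
only on its values on a finite subset of `X`. This is what allows the action to be extended to `G`
by approximation. -/
theorem of_smul_localStabilizer_eq_of_agree (ho : o ∈ Y)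
    (hW : ∀ w ∈ translators Γ o Y, w⁻¹ ∈ translators Γ o Y)
    (p : LocalGroup (translators Γ o Y) ⧸ localStabilizer (Γ := Γ) ho) :
    ∃ F : Finset X, o ∈ F ∧ ∀ w ∈ translators Γ o Y, ∀ w' : Γ, (∀ x ∈ F, w • x = w' • x) →
      of (translators Γ o Y) w • p = of (translators Γ o Y) w' • p := by
  classical
  have h1 : (1 : Γ) ∈ translators Γ o Y := show (1 : Γ) • o ∈ Y by rwa [one_smul]
  have hL : ∀ l : Γ, l • o = o → l ∈ translators Γ o Y := fun l hl => show l • o ∈ Y by rwa [hl]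
  have key : ∀ x : LocalGroup (translators Γ o Y), ∃ F : Finset X, o ∈ F ∧
      ∀ l : Γ, (∀ x ∈ F, l • x = x) → of (translators Γ o Y) l * x ∈
        (fun y => x * y) '' (localStabilizer (Γ := Γ) ho : Set _) := by
    refine induction_left h1 hW ⟨{o}, by simp, fun l hl => ⟨_, ⟨l, hl o (by simp), rfl⟩, by simp⟩⟩ ?_
    rintro a ha x ⟨F, ho, hF⟩
    -- If `l` fixes `o` and `a • F` pointwise, then `a⁻¹ * l * a` fixes `F` pointwise, and the
    -- triangles move `l` past `a`.
    refine ⟨insert o (F.image fun x => a • x), by simp, fun l hl => ?_⟩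
    have hlo : l • o = o := hl o (by simp)
    have hla : ∀ x ∈ F, l • a • x = a • x := fun x hx => hl _ (by
      rw [Finset.mem_insert, Finset.mem_image]
      exact Or.inr ⟨x, hx, rfl⟩)
    have hc : ∀ x ∈ F, (a⁻¹ * l * a) • x = x := fun x hx => by
      rw [mul_smul, mul_smul, hla x hx, inv_smul_smul]
    obtain ⟨y, hy, hxy⟩ := hF _ hc
    refine ⟨y, hy, ?_⟩
    have hla' : l * a ∈ translators Γ o Y := by
      change (l * a) • o ∈ Y
      rw [mul_smul, hla o ho]
      exact ha
    have hla2 : l * a = a * (a⁻¹ * l * a) := by group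
    dsimp only at hxy ⊢
    rw [← mul_assoc, ← of_mul (hL l hlo) ha hla', hla2, of_mul ha (hL _ (hc o ho)) (hla2 ▸ hla'),
      mul_assoc, mul_assoc, hxy]
  induction p using QuotientGroup.induction_on with | H x => ?_
  obtain ⟨F, hoF, hF⟩ := key x
  refine ⟨F, hoF, fun w hw w' h => ?_⟩
  have hc : ∀ x ∈ F, (w⁻¹ * w') • x = x := fun x hx => by
    rw [mul_smul, ← h x hx, inv_smul_smul]
  obtain ⟨y, hy, hxy⟩ := hF _ hc
  have hw' : w * (w⁻¹ * w') ∈ translators Γ o Y := by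
    rw [mul_inv_cancel_left]
    change w' • o ∈ Y
    rw [← h o hoF]
    exact hw
  have := of_mul hw (hL _ (hc o hoF)) hw'
  rw [mul_inv_cancel_left] at this
  rw [this, mul_smul, MulAction.Quotient.smul_mk, MulAction.Quotient.smul_mk,
    MulAction.Quotient.smul_mk, smul_eq_mul, smul_eq_mul, smul_eq_mul, ← hxy]
  refine QuotientGroup.eq.2 ?_
  rw [← mul_assoc, mul_inv_rev]
  simpa [mul_assoc] using hy

include hφ hd in
/-- Triangular presentations pass from a group to a dense subgroup. -/
theorem toAmbient_translators_bijective_of_dense' (ho : o ∈ Y)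
    (hV : ∀ v ∈ translators G o Y, v⁻¹ ∈ translators G o Y)
    (h : Function.Bijective (toAmbient (translators G o Y))) :
    Function.Bijective (toAmbient (translators Γ o Y)) := by
  classical
  have hW := translators_inv_mem_of_dense φ hφ hV
  have h1 : (1 : Γ) ∈ translators Γ o Y := show (1 : Γ) • o ∈ Y by rwa [one_smul]
  have h1V : (1 : G) ∈ translators G o Y := show (1 : G) • o ∈ Y by rwa [one_smul]
  choose F hoF hF using of_smul_localStabilizer_eq_of_agree (Γ := Γ) ho hW
  choose c hc using hd
  let Q := LocalGroup (translators Γ o Y) ⧸ localStabilizer (Γ := Γ) ho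
  -- By the choice of `F p`, replacing `c g (F p)` by any other approximation of a translator `g` on
  -- `F p` gives the same coset.
  let act : G → Q → Q := fun g p => of (translators Γ o Y) (c g (F p)) • p
  have hmem : ∀ g ∈ translators G o Y, ∀ w : Γ, ∀ E : Finset X, o ∈ E →
      (∀ x ∈ E, w • x = g • x) → w ∈ translators Γ o Y := fun g hg w E hE hx => by
    change w • o ∈ Y
    rw [hx o hE]
    exact hg
  have hact : ∀ g ∈ translators G o Y, ∀ p : Q, ∀ w : Γ, (∀ x ∈ F p, w • x = g • x) →
      act g p = of (translators Γ o Y) w • p := fun g hg p w hw =>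
    hF p _ (hmem g hg _ _ (hoF p) (hc g (F p))) w fun x hx => by rw [hc g (F p) x hx, hw x hx]
  have hmul : ∀ a ∈ translators G o Y, ∀ b ∈ translators G o Y, a * b ∈ translators G o Y →
      ∀ p, act (a * b) p = act a (act b p) := by
    intro a ha b hb hab p
    have hb' := hmem b hb _ _ (hoF p) (hc b (F p))
    set w := c b (F p) with hw
    have hbp : act b p = of (translators Γ o Y) w • p := rfl
    -- The set is chosen so that `w'` computes `act a` at `act b p` and `w' * w` approximates `a *
    -- b` on `F p`.
    obtain ⟨w', hw'⟩ : ∃ w' : Γ, ∀ x ∈ F (act b p) ∪ (F p).image fun x => w • x, w' • x = a • x :=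
      ⟨_, hc a _⟩
    have hw1 : ∀ x ∈ F (act b p), w' • x = a • x := fun x hx =>
      hw' x (Finset.mem_union_left _ hx)
    have hw2 : ∀ x ∈ F p, (w' * w) • x = (a * b) • x := fun x hx => by
      rw [mul_smul, mul_smul, hw' (w • x) (Finset.mem_union_right _ (Finset.mem_image_of_mem _ hx)),
        hc b (F p) x hx]
    rw [hact _ hab p _ hw2, hact a ha _ w' hw1, hbp, ← mul_smul,
      ← of_mul (hmem a ha _ _ (hoF _) hw1) hb' (hmem _ hab _ _ (hoF p) hw2)]
  have hone : ∀ p, act 1 p = p := fun p => by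
    rw [hact 1 h1V p 1 (by simp), of_one h1, one_smul]
  have hinv : ∀ a ∈ translators G o Y, ∀ p, act a (act a⁻¹ p) = p := fun a ha p => by
    rw [← hmul a ha _ (hV a ha) (by simpa using h1V), mul_inv_cancel, hone]
  let f : G → Equiv.Perm Q := fun g => if hg : g ∈ translators G o Y then
    { toFun := act g
      invFun := act g⁻¹
      left_inv := fun p => by simpa using hinv _ (hV g hg) p
      right_inv := hinv g hg } else 1
  have hf : ∀ g ∈ translators G o Y, ∀ p, f g p = act g p := fun g hg p => by
    simp only [f, dif_pos hg]
    rfl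
  let ρ : LocalGroup (translators G o Y) →* Equiv.Perm Q := lift f fun a ha b hb hab => by
    ext p
    rw [Equiv.Perm.mul_apply, hf _ hab, hf _ hb, hf _ ha, hmul a ha b hb hab]
  let e := (MulEquiv.ofBijective _ h).symm
  have he : ∀ w ∈ translators G o Y, e w = of _ w := fun w hw => by
    rw [MulEquiv.symm_apply_eq]
    exact (toAmbient_of hw).symm
  -- Left translation on `Q` factors through `toAmbient`. A kernel element therefore fixes the base
  -- coset, so it is `of _ l` with `l` fixing `o`, and `l = 1`.
  have hcomp : MulAction.toPermHom (LocalGroup (translators Γ o Y)) Q =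
      (ρ.comp e.toMonoidHom).comp (φ.comp (toAmbient (translators Γ o Y))) := by
    refine hom_ext fun w hw => ?_
    have hw' := (map_mem_translators_iff φ hφ).2 hw
    simp only [MonoidHom.comp_apply]
    rw [toAmbient_of hw]
    change _ = ρ (e (φ w))
    rw [he _ hw']
    ext p
    rw [show ρ (of _ (φ w)) = f (φ w) from lift_of hw', hf _ hw',
      hact _ hw' p w fun x _ => (hφ w x).symm]
    rfl
  refine ⟨(injective_iff_map_eq_one _).2 fun x hx => ?_, ?_⟩
  · have := DFunLike.congr_fun hcomp x
    simp only [MonoidHom.comp_apply] at this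
    rw [hx, map_one, map_one, map_one] at this
    have := Equiv.congr_fun this (QuotientGroup.mk 1)
    have : (QuotientGroup.mk (x * 1) : Q) = QuotientGroup.mk 1 := this
    rw [mul_one] at this
    have := QuotientGroup.eq.1 this.symm
    rw [inv_one, one_mul] at this
    obtain ⟨l, hl, rfl⟩ := this
    rw [toAmbient_of (A := translators Γ o Y) (show l • o ∈ Y by rwa [hl])] at hx
    rw [hx, of_one h1]
  · rw [toAmbient_surjective_iff]
    exact closure_translators_eq_top_of_dense' φ hφ (fun g F => ⟨_, hc g F⟩) ho hV
      (toAmbient_surjective_iff.1 h.2)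

end DenseAction

/-! ### Finite presentations from triangles over finitely many cosets. -/

section FinitePresentation

open LocalGroup Monoid

variable {Γ X : Type*} [Group Γ] [MulAction Γ X] {o : X} {Y : Set X}

/-- The translators are stable under right multiplication by the stabiliser; being symmetric, they
are stable under left multiplication too. -/
theorem smul_mem_of_symmetric (hW : ∀ w ∈ translators Γ o Y, w⁻¹ ∈ translators Γ o Y)
    {s : X → Γ} (hs : ∀ y ∈ Y, s y • o = y) {l : Γ} (hl : l • o = o) {y : X} (hy : y ∈ Y) :
    l • y ∈ Y := by
  have h1 : (s y)⁻¹ * l⁻¹ ∈ translators Γ o Y := by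
    change ((s y)⁻¹ * l⁻¹) • o ∈ Y
    rw [mul_smul, inv_smul_eq_iff.2 hl.symm]
    exact hW (s y) (show s y • o ∈ Y by rwa [hs y hy])
  have h2 : ((s y)⁻¹ * l⁻¹)⁻¹ • o ∈ Y := hW _ h1
  rwa [mul_inv_rev, inv_inv, inv_inv, mul_smul, hs y hy] at h2

/-- A map on `translators Γ o Y` built from a section `S` of the orbit map and a homomorphism `M` on
the stabiliser is multiplicative where it has to be. -/
theorem mul_of_section_relations {P : Type*} [Group P] (S : X → P) (M : Γ → P)
    (hM : ∀ a b : Γ, a • o = o → b • o = o → M (a * b) = M a * M b)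
    (hW : ∀ w ∈ translators Γ o Y, w⁻¹ ∈ translators Γ o Y)
    {s : X → Γ} (hs : ∀ y ∈ Y, s y • o = y)
    (hMS : ∀ l : Γ, l • o = o → ∀ y ∈ Y, M l * S y = S (l • y) * M ((s (l • y))⁻¹ * l * s y))
    (hSS : ∀ y ∈ Y, ∀ z ∈ Y, s y • z ∈ Y →
      S y * S z = S (s y • z) * M ((s (s y • z))⁻¹ * s y * s z))
    {a b : Γ} (ha : a ∈ translators Γ o Y) (hb : b ∈ translators Γ o Y)
    (hab : a * b ∈ translators Γ o Y) :
    S ((a * b) • o) * M ((s ((a * b) • o))⁻¹ * (a * b)) =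
      S (a • o) * M ((s (a • o))⁻¹ * a) * (S (b • o) * M ((s (b • o))⁻¹ * b)) := by
  have hst : ∀ w ∈ translators Γ o Y, ((s (w • o))⁻¹ * w) • o = o := fun w hw => by
    rw [mul_smul, inv_smul_eq_iff, hs _ hw]
  have hl := hst a ha
  set l := (s (a • o))⁻¹ * a with hl_def
  have hz : l • b • o ∈ Y := smul_mem_of_symmetric hW hs hl hb
  have hsz : s (a • o) • l • b • o = (a * b) • o := by
    rw [← mul_smul, ← mul_smul, hl_def, mul_inv_cancel_left]
  have h1 : ((s (l • b • o))⁻¹ * l * s (b • o)) • o = o := by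
    rw [mul_smul, mul_smul, hs _ hb, inv_smul_eq_iff, hs _ hz]
  have h2 : ((s ((a * b) • o))⁻¹ * s (a • o) * s (l • b • o)) • o = o := by
    rw [mul_smul, mul_smul, hs _ hz, inv_smul_eq_iff, hs _ hab, hsz]
  have h3 := hSS _ ha _ hz (by rw [hsz]; exact hab)
  rw [hsz] at h3
  -- With `a = s (a • o) * l`, `hMS` moves `l` past the section letter of `b`, `hSS` merges the two
  -- section letters, and `hM` collects the stabiliser factors.
  calc S ((a * b) • o) * M ((s ((a * b) • o))⁻¹ * (a * b))
      = S ((a * b) • o) * M ((s ((a * b) • o))⁻¹ * s (a • o) * s (l • b • o)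
        * ((s (l • b • o))⁻¹ * l * s (b • o)) * ((s (b • o))⁻¹ * b)) := by
        congr 2
        rw [hl_def]
        group
    _ = S (a • o) * S (l • b • o) * M ((s (l • b • o))⁻¹ * l * s (b • o))
        * M ((s (b • o))⁻¹ * b) := by
        rw [hM _ _ (by rw [mul_smul, h1, h2]) (hst b hb), hM _ _ h2 h1, h3]
        simp only [mul_assoc]
    _ = _ := by
        rw [mul_assoc (S (a • o)), ← hMS l hl _ hb]
        simp only [mul_assoc]

/-- A group presented by its triangles in `translators Γ o Y` with `Y` finite is finitely presented
when the stabiliser of `o` is. -/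
theorem Group.IsFinitelyPresented.of_toAmbient_translators_bijective (Λ : Subgroup Γ)
    (hΛ : ∀ l, l ∈ Λ ↔ l • o = o) (hY : Y.Finite) (ho : o ∈ Y)
    (htrans : ∀ y ∈ Y, ∃ g : Γ, g • o = y)
    (hW : ∀ w ∈ translators Γ o Y, w⁻¹ ∈ translators Γ o Y)
    (h : Function.Bijective (toAmbient (translators Γ o Y)))
    [hfp : Group.IsFinitelyPresented Λ] : Group.IsFinitelyPresented Γ := by
  classical
  have hfg : Group.FG Λ := by
    obtain ⟨n, φ, hφ, -⟩ := hfp.out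
    exact Group.fg_of_surjective hφ
  obtain ⟨T, hT, hTfin⟩ := (Subgroup.fg_iff Λ).1 ((Group.fg_iff_subgroup_fg Λ).1 hfg)
  have : Finite Y := hY
  choose! s hs using htrans
  let ℓ : Γ → Coprod Λ (FreeGroup Y) := fun g => if hg : g ∈ Λ then Coprod.inl ⟨g, hg⟩ else 1
  let σ : X → Coprod Λ (FreeGroup Y) := fun x =>
    if hx : x ∈ Y then Coprod.inr (FreeGroup.of ⟨x, hx⟩) else 1
  have hℓ : ∀ l : Λ, ℓ l = Coprod.inl l := fun l => dif_pos l.2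
  have hσ : ∀ y : Y, σ y = Coprod.inr (FreeGroup.of y) := fun y => dif_pos y.2
  let ψ : Coprod Λ (FreeGroup Y) →* Γ := Coprod.lift Λ.subtype (FreeGroup.lift fun y => s y)
  have hψℓ : ∀ l ∈ Λ, ψ (ℓ l) = l := fun l hl => by
    rw [hℓ ⟨l, hl⟩]
    simp [ψ]
  have hψσ : ∀ y ∈ Y, ψ (σ y) = s y := fun y hy => by
    rw [hσ ⟨y, hy⟩]
    simp [ψ]
  have hΛY : ∀ l ∈ Λ, ∀ y ∈ Y, l • y ∈ Y := fun l hl y hy =>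
    smul_mem_of_symmetric hW hs ((hΛ l).1 hl) hy
  let r₁ : Γ × X → Coprod Λ (FreeGroup Y) := fun p =>
    ℓ p.1 * σ p.2 * (σ (p.1 • p.2) * ℓ ((s (p.1 • p.2))⁻¹ * p.1 * s p.2))⁻¹
  let r₂ : X × X → Coprod Λ (FreeGroup Y) := fun p =>
    σ p.1 * σ p.2 * (σ (s p.1 • p.2) * ℓ ((s (s p.1 • p.2))⁻¹ * s p.1 * s p.2))⁻¹
  -- Finiteness comes from imposing the commutation relations only for the generators `T` of `Λ`;
  -- the last relator identifies the letter of `o` with an element of `Λ`.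
  let R : Set (Coprod Λ (FreeGroup Y)) :=
    r₁ '' (T ×ˢ Y) ∪ r₂ '' {p ∈ Y ×ˢ Y | s p.1 • p.2 ∈ Y} ∪ {σ o * (ℓ (s o))⁻¹}
  have hRfin : R.Finite := (((hTfin.prod hY).image _).union
    (((hY.prod hY).subset (Set.sep_subset _ _)).image _)).union (Set.finite_singleton _)
  have hmem₁ : ∀ l ∈ Λ, ∀ y ∈ Y, (s (l • y))⁻¹ * l * s y ∈ Λ := fun l hl y hy => by
    rw [hΛ, mul_smul, mul_smul, hs y hy, inv_smul_eq_iff, hs _ (hΛY l hl y hy)]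
  have hmem₂ : ∀ y ∈ Y, ∀ z ∈ Y, s y • z ∈ Y → (s (s y • z))⁻¹ * s y * s z ∈ Λ :=
    fun y _ z hz hyz => by
    rw [hΛ, mul_smul, mul_smul, hs z hz, inv_smul_eq_iff, hs _ hyz]
  have hso : s o ∈ Λ := (hΛ _).2 (hs o ho)
  have hTΛ : ∀ t ∈ T, t ∈ Λ := fun t ht => hT ▸ Subgroup.subset_closure ht
  have hRker : Subgroup.normalClosure R ≤ ψ.ker := by
    refine Subgroup.normalClosure_le_normal ?_
    rintro _ ((⟨⟨t, y⟩, ⟨ht, hy⟩, rfl⟩ | ⟨⟨y, z⟩, ⟨⟨hy, hz⟩, hyz⟩, rfl⟩) | rfl)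
    · change ψ _ = 1
      have ht := hTΛ t ht
      dsimp only at ht hy
      simp only [r₁, map_mul, map_inv]
      rw [hψℓ t ht, hψσ y hy, hψσ _ (hΛY t ht y hy), hψℓ _ (hmem₁ t ht y hy)]
      group
    · change ψ _ = 1
      dsimp only at hy hz hyz
      simp only [r₂, map_mul, map_inv]
      rw [hψσ y hy, hψσ z hz, hψσ _ hyz, hψℓ _ (hmem₂ y hy z hz hyz)]
      group
    · change ψ _ = 1
      rw [map_mul, map_inv, hψσ o ho, hψℓ _ hso, mul_inv_cancel]
  let π := QuotientGroup.mk' (Subgroup.normalClosure R)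
  have hπ : ∀ x y, x * y⁻¹ ∈ R → π x = π y := fun x y hxy => by
    rw [← mul_inv_eq_one, ← map_inv, ← map_mul]
    exact (QuotientGroup.eq_one_iff _).2 (Subgroup.subset_normalClosure hxy)
  have hM : ∀ a b : Γ, a • o = o → b • o = o → π (ℓ (a * b)) = π (ℓ a) * π (ℓ b) := by
    intro a b ha hb
    rw [← hΛ] at ha hb
    rw [hℓ ⟨a, ha⟩, hℓ ⟨b, hb⟩, show ℓ (a * b) = _ from hℓ (⟨a, ha⟩ * ⟨b, hb⟩), map_mul, map_mul]
  have hM1 : π (ℓ 1) = 1 := by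
    rw [show ℓ 1 = _ from hℓ 1, map_one, map_one]
  have hMinv : ∀ a ∈ Λ, π (ℓ a⁻¹) = (π (ℓ a))⁻¹ := fun a ha => by
    refine eq_inv_of_mul_eq_one_left ?_
    rw [← hM _ _ ((hΛ _).1 (Λ.inv_mem ha)) ((hΛ _).1 ha), inv_mul_cancel, hM1]
  have hSS : ∀ y ∈ Y, ∀ z ∈ Y, s y • z ∈ Y → π (σ y) * π (σ z) =
      π (σ (s y • z)) * π (ℓ ((s (s y • z))⁻¹ * s y * s z)) := fun y hy z hz hyz => by
    rw [← map_mul, ← map_mul]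
    exact hπ _ _ (Or.inl (Or.inr ⟨(y, z), ⟨⟨hy, hz⟩, hyz⟩, rfl⟩))
  -- The commutation relations extend from `T` to all of `Λ` because the correction terms `(s (l •
  -- y))⁻¹ * l * s y` satisfy a cocycle identity.
  have hMS : ∀ l : Γ, l • o = o → ∀ y ∈ Y, π (ℓ l) * π (σ y) =
      π (σ (l • y)) * π (ℓ ((s (l • y))⁻¹ * l * s y)) := by
    intro l hl
    rw [← hΛ, ← hT] at hl
    induction hl using Subgroup.closure_induction with
    | mem t ht =>
      intro y hy
      rw [← map_mul, ← map_mul]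
      exact hπ _ _ (Or.inl (Or.inl ⟨(t, y), ⟨ht, hy⟩, rfl⟩))
    | one =>
      intro y hy
      rw [one_smul, mul_one, inv_mul_cancel, hM1, one_mul, mul_one]
    | mul a b ha hb iha ihb =>
      rw [hT] at ha hb
      intro y hy
      have hby := hΛY b hb y hy
      rw [hM a b ((hΛ a).1 ha) ((hΛ b).1 hb), mul_assoc, ihb y hy, ← mul_assoc, iha _ hby,
        mul_assoc, ← hM _ _ ((hΛ _).1 (hmem₁ a ha _ hby)) ((hΛ _).1 (hmem₁ b hb y hy)), mul_smul]
      congr 3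
      group
    | inv a ha iha =>
      rw [hT] at ha
      intro y hy
      have hay := hΛY a⁻¹ (Λ.inv_mem ha) y hy
      have key := iha _ hay
      have hmem := hmem₁ a ha _ hay
      rw [smul_inv_smul] at key hmem
      rw [hMinv a ha, inv_mul_eq_iff_eq_mul, ← mul_assoc, key, mul_assoc,
        ← hM _ _ ((hΛ _).1 hmem) ((hΛ _).1 (hmem₁ a⁻¹ (Λ.inv_mem ha) y hy))]
      rw [show (s y)⁻¹ * a * s (a⁻¹ • y) * ((s (a⁻¹ • y))⁻¹ * a⁻¹ * s y) = 1 by group, hM1, mul_one]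
  have hSo : π (σ o) = π (ℓ (s o)) := hπ _ _ (Or.inr rfl)
  let θ' : LocalGroup (translators Γ o Y) →* Coprod Λ (FreeGroup Y) ⧸ Subgroup.normalClosure R :=
    lift (fun w => π (σ (w • o)) * π (ℓ ((s (w • o))⁻¹ * w))) fun a ha b hb hab =>
      mul_of_section_relations (fun x => π (σ x)) (fun g => π (ℓ g)) hM hW hs hMS hSS ha hb hab
  let e := (MulEquiv.ofBijective _ h).symm
  have he : ∀ w ∈ translators Γ o Y, e w = of _ w := fun w hw => by
    rw [MulEquiv.symm_apply_eq]
    exact (toAmbient_of hw).symm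
  let θ := θ'.comp e.toMonoidHom
  have hθ : ∀ w ∈ translators Γ o Y, θ w = π (σ (w • o)) * π (ℓ ((s (w • o))⁻¹ * w)) :=
    fun w hw => by
    change θ' (e w) = _
    rw [he w hw]
    exact lift_of hw
  -- This factorisation puts the kernel of `ψ` inside the normal closure of `R`.
  have hθψ : θ.comp ψ = π := by
    refine Coprod.hom_ext (MonoidHom.ext fun l => ?_) (FreeGroup.ext_hom _ _ fun y => ?_)
    · have hl := (hΛ _).1 l.2
      simp only [MonoidHom.comp_apply]
      rw [← hℓ l, hψℓ l l.2, hθ _ (show (l : Γ) • o ∈ Y by rwa [hl]), hl, hSo,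
        ← hM _ _ ((hΛ _).1 hso) ((hΛ _).1 (Λ.mul_mem (Λ.inv_mem hso) l.2)), mul_inv_cancel_left]
    · simp only [MonoidHom.comp_apply]
      rw [← hσ y, hψσ y y.2, hθ _ (show s y • o ∈ Y by rw [hs y y.2]; exact y.2), hs y y.2,
        inv_mul_cancel, hM1, mul_one]
  have hker : ψ.ker = Subgroup.normalClosure R := by
    refine le_antisymm (fun x hx => ?_) hRker
    rw [← QuotientGroup.ker_mk' (Subgroup.normalClosure R)]
    change π x = 1
    rw [← hθψ, MonoidHom.comp_apply, MonoidHom.mem_ker.1 hx, map_one]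
  have hsurj : Function.Surjective ψ := by
    rw [← MonoidHom.range_eq_top, ← top_le_iff, ← toAmbient_surjective_iff.1 h.2,
      Subgroup.closure_le]
    intro w hw
    have hw' : (s (w • o))⁻¹ * w ∈ Λ := by
      rw [hΛ, mul_smul, inv_smul_eq_iff, hs _ hw]
    refine ⟨σ (w • o) * ℓ ((s (w • o))⁻¹ * w), ?_⟩
    rw [map_mul, hψσ _ hw, hψℓ _ hw', mul_inv_cancel_left]
  exact Group.IsFinitelyPresented.of_surjective ψ hsurj ⟨R, hRfin, hker.symm⟩

end FinitePresentation

/-! ### Compact subgroups are generated inside a large ball. -/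

/-- By Baire some `B i` has interior in `U`, so the subgroup generated by its trace is open. The
subgroups from larger indices form an increasing open cover of the compact `U`. -/
theorem Subgroup.exists_le_closure_inter_of_isCompact {G : Type*} [Group G] [TopologicalSpace G]
    [IsTopologicalGroup G] [T2Space G] (U : Subgroup G) (hU : IsCompact (U : Set G))
    (B : ℕ → Set G) (hB : ∀ n, IsClosed (B n)) (hmono : Monotone B) (hcov : ∀ u ∈ U, ∃ n, u ∈ B n) :
    ∃ n, U ≤ Subgroup.closure (U ∩ B n) := by
  have : CompactSpace U := isCompact_iff_compactSpace.1 hU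
  let C : ℕ → Set U := fun n => Subtype.val ⁻¹' B n
  have hC : ∀ n, IsClosed (C n) := fun n => (hB n).preimage continuous_subtype_val
  obtain ⟨i, x, hx⟩ := nonempty_interior_of_iUnion_of_closed hC
    (Set.eq_univ_of_forall fun u => Set.mem_iUnion.2 (hcov u u.2))
  let D : ℕ → Subgroup U := fun n => Subgroup.closure (C n)
  have hD : Monotone D := fun m n h => Subgroup.closure_mono (Set.preimage_mono (hmono h))
  have hDi : IsOpen (D i : Set U) := Subgroup.isOpen_of_mem_nhds _
    (Filter.mem_of_superset (mem_interior_iff_mem_nhds.1 hx) Subgroup.subset_closure)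
  have hopen : ∀ n, IsOpen (D (max i n) : Set U) := fun n =>
    Subgroup.isOpen_mono (hD (le_max_left i n)) hDi
  obtain ⟨n, hn⟩ := isCompact_univ.elim_directed_cover (fun n => (D (max i n) : Set U)) hopen
    (fun u _ => Set.mem_iUnion.2 (by
      obtain ⟨n, hn⟩ := hcov u u.2
      exact ⟨n, hD (le_max_right i n) (Subgroup.subset_closure hn)⟩))
    (Monotone.directed_le fun m n h => hD (max_le_max le_rfl h))
  refine ⟨max i n, fun u hu => ?_⟩
  have h : (⟨u, hu⟩ : U) ∈ D (max i n) := hn (Set.mem_univ _)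
  have h' : D (max i n) ≤ (Subgroup.closure ((U : Set G) ∩ B (max i n))).comap U.subtype :=
    (Subgroup.closure_le _).2 fun y hy => Subgroup.subset_closure ⟨y.2, hy⟩
  exact h' h

/-! ### Compactness in the pointwise topology. -/

section PermTopology

variable {X : Type*}

instance permPointwise_t2Space : T2Space (Equiv.Perm X) := by
  refine t2_iff_isClosed_diagonal.2 ?_
  rw [← isOpen_compl_iff]
  have : (Set.diagonal (Equiv.Perm X))ᶜ = ⋃ (x : X) (y : X) (z : X) (_ : y ≠ z),
      {σ : Equiv.Perm X | σ x = y} ×ˢ {σ : Equiv.Perm X | σ x = z} := by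
    ext ⟨σ, τ⟩
    simp only [Set.mem_compl_iff, Set.mem_diagonal_iff, Set.mem_iUnion, Set.mem_prod,
      Set.mem_ofPred_eq]
    constructor
    · intro h
      by_contra! h'
      exact h (Equiv.ext fun x => by_contra fun hx => h' x _ _ hx rfl rfl)
    · rintro ⟨x, y, z, hyz, rfl, rfl⟩ rfl
      exact hyz rfl
  rw [this]
  exact isOpen_iUnion fun x => isOpen_iUnion fun y => isOpen_iUnion fun z => isOpen_iUnion fun _ =>
    (isOpen_perm_apply_eq x y).prod (isOpen_perm_apply_eq x z)

/-- A closed set of permutations that, with their inverses, move every point to finitely many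
points is compact. -/
theorem isCompact_perm_of_finite {C : Set (Equiv.Perm X)} (hC : IsClosed C)
    (h1 : ∀ x, ((fun σ : Equiv.Perm X => σ x) '' C).Finite)
    (h2 : ∀ x, ((fun σ : Equiv.Perm X => σ⁻¹ x) '' C).Finite) : IsCompact C := by
  rw [isCompact_iff_ultrafilter_le_nhds]
  intro F hF
  have hFC : C ∈ F := Filter.le_principal_iff.1 hF
  have hlim : ∀ f : Equiv.Perm X → X, (f '' C).Finite → ∃ y, {σ | f σ = y} ∈ F := fun f hf => by
    have hm : (⋃ y ∈ f '' C, {σ | f σ = y}) ∈ F :=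
      Filter.mem_of_superset hFC fun σ hσ => by
        simp only [Set.mem_iUnion]
        exact ⟨f σ, ⟨σ, hσ, rfl⟩, rfl⟩
    obtain ⟨y, -, hy⟩ := (Ultrafilter.finite_biUnion_mem_iff hf).1 hm
    exact ⟨y, hy⟩
  choose a ha using fun x => hlim (fun σ => σ x) (h1 x)
  -- The limit of the inverses is needed as well: a pointwise limit of permutations need not be
  -- surjective.
  choose b hb using fun x => hlim (fun σ => σ⁻¹ x) (h2 x)
  let τ : Equiv.Perm X :=
    { toFun := a
      invFun := b
      left_inv := fun x => by
        obtain ⟨σ, hσ, hσ'⟩ := F.nonempty_of_mem (Filter.inter_mem (ha x) (hb (a x)))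
        rw [← (hσ' : σ⁻¹ (a x) = b (a x)), ← (hσ : σ x = a x)]
        simp
      right_inv := fun x => by
        obtain ⟨σ, hσ, hσ'⟩ := F.nonempty_of_mem (Filter.inter_mem (hb x) (ha (b x)))
        rw [← (hσ' : σ (b x) = a (b x)), ← (hσ : σ⁻¹ x = b x)]
        simp }
  have hτ : (F : Filter (Equiv.Perm X)) ≤ nhds τ := by
    let _ : TopologicalSpace X := ⊥
    have _ : DiscreteTopology X := ⟨rfl⟩
    rw [nhds_induced, ← Filter.tendsto_iff_comap, tendsto_pi_nhds]
    intro x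
    rw [nhds_discrete, Filter.tendsto_pure]
    exact ha x
  exact ⟨τ, isClosed_iff_ultrafilter.1 hC τ F hτ hFC, hτ⟩

theorem exists_mem_agree_of_mem_closure {S : Set (Equiv.Perm X)} {σ : Equiv.Perm X}
    (hσ : σ ∈ closure S) (F : Finset X) : ∃ τ ∈ S, ∀ x ∈ F, τ x = σ x := by
  have hopen : IsOpen (⋂ x ∈ F, {τ : Equiv.Perm X | τ x = σ x}) :=
    isOpen_biInter_finset fun x _ => isOpen_perm_apply_eq x (σ x)
  obtain ⟨τ, hτ, hτS⟩ := mem_closure_iff.1 hσ _ hopen (by simp)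
  exact ⟨τ, hτS, by simpa using hτ⟩

variable (G : Subgroup (Equiv.Perm X))

theorem isOpen_subgroup_smul_mem (o : X) (Y : Set X) : IsOpen {g : G | g • o ∈ Y} := by
  have : {g : G | g • o ∈ Y} =
      Subtype.val ⁻¹' ⋃ y ∈ Y, {σ : Equiv.Perm X | σ o = y} := by
    ext g
    simp [Subgroup.smul_def]
  rw [this]
  exact (isOpen_biUnion fun y _ => isOpen_perm_apply_eq o y).preimage continuous_subtype_val

theorem isClosed_subgroup_smul_mem (o : X) (Y : Set X) : IsClosed {g : G | g • o ∈ Y} := by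
  rw [← isOpen_compl_iff]
  exact isOpen_subgroup_smul_mem G o Yᶜ

theorem image_smul_finite_of_isCompact {K : Set G} (hK : IsCompact K) (o : X) :
    ((fun g : G => g • o) '' K).Finite := by
  let _ : TopologicalSpace X := ⊥
  have _ : DiscreteTopology X := ⟨rfl⟩
  have hc : Continuous fun g : G => g • o :=
    continuous_def.2 fun Y _ => isOpen_subgroup_smul_mem G o Y
  exact (hK.image hc).finite_of_discrete

end PermTopology

/-! ### Density and compactness in the Schlichting completion. -/

section Schlichting

open Subgroup

variable {Γ : Type*} [Group Γ] (Λ : Subgroup Γ)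

/-- The homomorphism from a group to its Schlichting completion. -/
def toSchlichtingCompletion : Γ →* schlichtingCompletion Λ :=
  (MulAction.toPermHom Γ (Γ ⧸ Λ)).codRestrict _ fun γ =>
    Subgroup.le_topologicalClosure _ ⟨γ, rfl⟩

theorem toSchlichtingCompletion_smul (γ : Γ) (x : Γ ⧸ Λ) :
    toSchlichtingCompletion Λ γ • x = γ • x := rfl

theorem schlichtingCompletion_dense (g : schlichtingCompletion Λ) (F : Finset (Γ ⧸ Λ)) :
    ∃ γ : Γ, ∀ x ∈ F, γ • x = g • x := by
  obtain ⟨_, ⟨γ, rfl⟩, hγ⟩ := exists_mem_agree_of_mem_closure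
    (S := (MulAction.toPermHom Γ (Γ ⧸ Λ)).range) g.2 F
  exact ⟨γ, hγ⟩

theorem isClosed_schlichtingCompletion :
    IsClosed (schlichtingCompletion Λ : Set (Equiv.Perm (Γ ⧸ Λ))) :=
  Subgroup.isClosed_topologicalClosure _

variable {Λ}

theorem smul_mk_one_eq_iff (l : Γ) : l ∈ Λ ↔ l • (QuotientGroup.mk 1 : Γ ⧸ Λ) = QuotientGroup.mk 1 := by
  rw [MulAction.Quotient.smul_mk, eq_comm, QuotientGroup.eq]
  simp

/-- The stabiliser in `Λ` of the coset of `g` is `Λ ∩ gΛg⁻¹`, which has finite index in `Λ`. -/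
theorem Subgroup.IsCommensurated.orbit_finite (hΛ : Λ.IsCommensurated) (x : Γ ⧸ Λ) :
    (MulAction.orbit Λ x).Finite := by
  induction x using QuotientGroup.induction_on with | H g => ?_
  have hg : g ∈ Commensurable.commensurator Λ := by rw [hΛ]; trivial
  have hidx := (Commensurable.commensurator_mem_iff Λ g).1 hg |>.1
  have hstab : (MulAction.stabilizer Λ (QuotientGroup.mk g : Γ ⧸ Λ)) =
      (ConjAct.toConjAct g • Λ).subgroupOf Λ := by
    ext l
    rw [MulAction.mem_stabilizer_iff, Subgroup.mem_subgroupOf,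
      Subgroup.mem_pointwise_smul_iff_inv_smul_mem, ← ConjAct.toConjAct_inv,
      ConjAct.toConjAct_smul,
      show l • (QuotientGroup.mk g : Γ ⧸ Λ) = QuotientGroup.mk ((l : Γ) * g) from rfl, eq_comm,
      QuotientGroup.eq]
    simp [mul_assoc]
  have : Finite (Λ ⧸ MulAction.stabilizer Λ (QuotientGroup.mk g : Γ ⧸ Λ)) := by
    rw [hstab]
    exact Subgroup.index_ne_zero_iff_finite.1 hidx
  exact Finite.of_equiv _ (MulAction.orbitEquivQuotientStabilizer Λ _).symm

/-- On `o` and `x` the element `g` agrees with some `γ`, which is a representative of a coset in `Y`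
times an element of `Λ`; both factors leave finitely many choices for `g • x`. -/
theorem image_translators_finite (hΛ : Λ.IsCommensurated) {Y : Set (Γ ⧸ Λ)} (hY : Y.Finite)
    (x : Γ ⧸ Λ) :
    ((fun g : schlichtingCompletion Λ => g • x) ''
      translators (schlichtingCompletion Λ) (QuotientGroup.mk 1 : Γ ⧸ Λ) Y).Finite := by
  have hfin : (⋃ y ∈ Y, (fun z => Quotient.out y • z) '' MulAction.orbit Λ x).Finite :=
    hY.biUnion fun y _ => (hΛ.orbit_finite x).image _
  refine hfin.subset ?_
  rintro _ ⟨g, hg, rfl⟩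
  classical
  obtain ⟨γ, hγ⟩ := schlichtingCompletion_dense Λ g {QuotientGroup.mk 1, x}
  have h1 : γ • (QuotientGroup.mk 1 : Γ ⧸ Λ) = g • (QuotientGroup.mk 1 : Γ ⧸ Λ) := hγ _ (by simp)
  have h2 : γ • x = g • x := hγ _ (by simp)
  simp only [Set.mem_iUnion]
  refine ⟨_, hg, ?_⟩
  rw [← h1, ← h2]
  set y := γ • (QuotientGroup.mk 1 : Γ ⧸ Λ) with hy
  have hyo : Quotient.out y • (QuotientGroup.mk 1 : Γ ⧸ Λ) = y := by
    rw [MulAction.Quotient.smul_mk, smul_eq_mul, mul_one]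
    exact Quotient.out_eq y
  have hl : (Quotient.out y)⁻¹ * γ ∈ Λ := by
    rw [smul_mk_one_eq_iff, mul_smul, inv_smul_eq_iff, hyo]
  refine ⟨_, ⟨⟨_, hl⟩, rfl⟩, ?_⟩
  change Quotient.out y • ((Quotient.out y)⁻¹ * γ) • x = γ • x
  rw [← mul_smul, mul_inv_cancel_left]

theorem isCompact_translators (hΛ : Λ.IsCommensurated) {Y : Set (Γ ⧸ Λ)} (hY : Y.Finite)
    (hV : ∀ v ∈ translators (schlichtingCompletion Λ) (QuotientGroup.mk 1 : Γ ⧸ Λ) Y,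
      v⁻¹ ∈ translators (schlichtingCompletion Λ) (QuotientGroup.mk 1 : Γ ⧸ Λ) Y) :
    IsCompact (translators (schlichtingCompletion Λ) (QuotientGroup.mk 1 : Γ ⧸ Λ) Y) := by
  rw [Subtype.isCompact_iff]
  refine isCompact_perm_of_finite ((isClosed_schlichtingCompletion Λ).isClosedMap_subtype_val _
    (isClosed_subgroup_smul_mem _ _ _)) (fun x => ?_) (fun x => ?_)
  · rw [Set.image_image]
    exact image_translators_finite hΛ hY x
  · rw [Set.image_image]
    refine (image_translators_finite hΛ hY x).subset ?_
    rintro _ ⟨v, hv, rfl⟩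
    exact ⟨v⁻¹, hV v hv, rfl⟩

end Schlichting

/-! ### Double cosets of the stabiliser, and compact presentations from triangles. -/

open LocalGroup

/-- A set stable under right multiplication by the stabiliser is determined by its image in the
orbit. This puts thickened balls in the form required by the transport results. -/
theorem translators_image_stabilizer_mul {H X : Type*} [Group H] [MulAction H X] (o : X)
    (S : Set H) :
    translators H o ((fun g => g • o) '' ((MulAction.stabilizer H o : Set H) * S *
      (MulAction.stabilizer H o : Set H))) =
      (MulAction.stabilizer H o : Set H) * S * (MulAction.stabilizer H o : Set H) := by
  ext g
  refine ⟨?_, fun hg => ⟨g, hg, rfl⟩⟩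
  rintro ⟨_, ⟨x, hx, l, hl, rfl⟩, h⟩
  have hl' : l • o = o := hl
  refine ⟨x, hx, x⁻¹ * g, ?_, by simp⟩
  change (x⁻¹ * g) • o = o
  have h' : (x * l) • o = g • o := h
  rw [mul_smul, ← h', mul_smul, hl', inv_smul_smul]

theorem inv_mem_stabilizer_mul {H X : Type*} [Group H] [MulAction H X] (o : X)
    {S : Set H} (hS : S⁻¹ = S) :
    ∀ g ∈ (MulAction.stabilizer H o : Set H) * S * (MulAction.stabilizer H o : Set H),
      g⁻¹ ∈ (MulAction.stabilizer H o : Set H) * S * (MulAction.stabilizer H o : Set H) := by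
  intro g hg
  rw [← Set.mem_inv, mul_inv_rev, mul_inv_rev, hS, inv_coe_set, ← mul_assoc]
  exact hg

theorem mem_image_stabilizer_mul {H X : Type*} [Group H] [MulAction H X] (o : X)
    {S : Set H} (hS : (1 : H) ∈ S) :
    o ∈ (fun g => g • o) '' ((MulAction.stabilizer H o : Set H) * S *
      (MulAction.stabilizer H o : Set H)) :=
  ⟨1, ⟨1, ⟨1, Subgroup.one_mem _, 1, hS, by simp⟩, 1, Subgroup.one_mem _, by simp⟩, one_smul _ _⟩

theorem isCompact_letters {G : Type*} [Group G] [TopologicalSpace G] [IsTopologicalGroup G]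
    {K : Set G} (hK : IsCompact K) : IsCompact (letters ((↑) : K → G)) := by
  rw [letters, Subtype.range_coe]
  exact (hK.union hK.inv).union isCompact_singleton

theorem isCompact_letters_pow {G : Type*} [Group G] [TopologicalSpace G] [IsTopologicalGroup G]
    {K : Set G} (hK : IsCompact K) (n : ℕ) : IsCompact (letters ((↑) : K → G) ^ n) := by
  induction n with
  | zero => simp
  | succ n ih =>
    rw [pow_succ]
    exact ih.mul (isCompact_letters hK)

theorem isCompactlyPresentedGroup_of_toAmbient_bijective {G : Type*} [Group G]
    [TopologicalSpace G] {K : Set G} (hK : IsCompact K) (h : Function.Bijective (toAmbient K)) :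
    IsCompactlyPresentedGroup G := by
  refine ⟨K, hK, toAmbient_surjective_iff.1 h.2, 3, triangleRelators K, ?_, ?_⟩
  · rintro _ ⟨a, b, c, -, rfl⟩
    exact ⟨[(a, true), (b, true), (c, false)], le_rfl, rfl⟩
  · have hcomp : (toAmbient K).comp (PresentedGroup.mk (triangleRelators K)) =
        FreeGroup.lift fun k : K => (k : G) := by
      refine FreeGroup.ext_hom _ _ fun k => ?_
      rw [FreeGroup.lift_apply_of, MonoidHom.comp_apply, ← toAmbient_of k.2, of_mem k.2]
      rfl
    ext x
    rw [← hcomp, MonoidHom.mem_ker, MonoidHom.comp_apply, map_eq_one_iff _ h.1,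
      PresentedGroup.mk_eq_one_iff]

/-! ### The four implications. -/

section Schlichting

variable {Γ : Type*} [Group Γ] {Λ : Subgroup Γ}

theorem stabilizer_mk_one (Λ : Subgroup Γ) :
    MulAction.stabilizer Γ (QuotientGroup.mk 1 : Γ ⧸ Λ) = Λ := by
  ext l
  exact (smul_mk_one_eq_iff l).symm

theorem isCompact_stabilizer (hΛ : Λ.IsCommensurated) :
    IsCompact (MulAction.stabilizer (schlichtingCompletion Λ) (QuotientGroup.mk 1 : Γ ⧸ Λ) :
      Set (schlichtingCompletion Λ)) :=
  isCompact_translators hΛ (Y := {QuotientGroup.mk 1}) (Set.finite_singleton _)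
    fun _ hv => inv_smul_eq_iff.2 (Set.mem_singleton_iff.1 hv).symm

/-- A translator is a chosen representative of a coset in `Y` times an element of `Λ`. -/
theorem fg_of_closure_translators {Y : Set (Γ ⧸ Λ)} (hY : Y.Finite)
    (h : Subgroup.closure (translators Γ (QuotientGroup.mk 1 : Γ ⧸ Λ) Y) = ⊤)
    (hfg : Group.FG Λ) : Group.FG Γ := by
  obtain ⟨T, hT, hTfin⟩ := (Subgroup.fg_iff Λ).1 ((Group.fg_iff_subgroup_fg Λ).1 hfg)
  obtain ⟨q, hq⟩ : ∃ q : Γ ⧸ Λ → Γ, ∀ x, q x • (QuotientGroup.mk 1 : Γ ⧸ Λ) = x :=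
    ⟨fun x => (MulAction.exists_smul_eq Γ _ x).choose,
      fun x => (MulAction.exists_smul_eq Γ _ x).choose_spec⟩
  refine Group.fg_iff.2 ⟨T ∪ q '' Y, ?_, hTfin.union (hY.image _)⟩
  rw [← top_le_iff, ← h, Subgroup.closure_le]
  intro w hw
  have hl : (q (w • QuotientGroup.mk 1))⁻¹ * w ∈ Λ := by
    rw [smul_mk_one_eq_iff, mul_smul, inv_smul_eq_iff, hq]
  replace hl := hT.ge hl
  have := Subgroup.mul_mem _
    (Subgroup.subset_closure (Set.mem_union_right T (Set.mem_image_of_mem q hw)))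
    (Subgroup.closure_mono (Set.subset_union_left (t := q '' Y)) hl)
  rwa [mul_inv_cancel_left] at this

theorem fg_of_isCompactlyGenerated_schlichtingCompletion (hΛ : Λ.IsCommensurated)
    (hG : IsCompactlyGeneratedGroup (schlichtingCompletion Λ)) (hfg : Group.FG Λ) :
    Group.FG Γ := by
  obtain ⟨K, hK, hKtop⟩ := hG
  have hU := isCompact_stabilizer hΛ
  have hV := translators_image_stabilizer_mul (H := schlichtingCompletion Λ)
    (QuotientGroup.mk 1 : Γ ⧸ Λ) (letters ((↑) : K → schlichtingCompletion Λ))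
  have hsymm := inv_mem_stabilizer_mul (H := schlichtingCompletion Λ)
    (QuotientGroup.mk 1 : Γ ⧸ Λ) (letters_inv ((↑) : K → schlichtingCompletion Λ))
  have ho := mem_image_stabilizer_mul (H := schlichtingCompletion Λ)
    (QuotientGroup.mk 1 : Γ ⧸ Λ) (one_mem_letters ((↑) : K → schlichtingCompletion Λ))
  have hY := image_smul_finite_of_isCompact _ ((hU.mul (isCompact_letters hK)).mul hU)
    (QuotientGroup.mk 1 : Γ ⧸ Λ)
  refine fg_of_closure_translators hY ?_ hfg
  refine closure_translators_eq_top_of_dense' (toSchlichtingCompletion Λ)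
    (toSchlichtingCompletion_smul Λ) (schlichtingCompletion_dense Λ) ho (by rwa [hV]) ?_
  rw [hV, ← top_le_iff, ← hKtop]
  refine Subgroup.closure_mono fun k hk => ?_
  exact ⟨k, ⟨1, Subgroup.one_mem _, k, mem_letters _ (⟨k, hk⟩ : K), by simp⟩, 1,
    Subgroup.one_mem _, by simp⟩

theorem isFinitelyPresented_of_isCompactlyPresented_schlichtingCompletion
    (hΛ : Λ.IsCommensurated) (hG : IsCompactlyPresentedGroup (schlichtingCompletion Λ))
    (hfp : Group.IsFinitelyPresented Λ) : Group.IsFinitelyPresented Γ := by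
  obtain ⟨K, hK, hKtop, n, R, hR, hker⟩ := hG
  have hU := isCompact_stabilizer hΛ
  have hKtop' : Subgroup.closure (Set.range ((↑) : K → schlichtingCompletion Λ)) = ⊤ := by
    rwa [Subtype.range_coe]
  obtain ⟨m, hm⟩ := Subgroup.exists_le_closure_inter_of_isCompact _ hU
    (fun n => letters ((↑) : K → schlichtingCompletion Λ) ^ n)
    (fun n => (isCompact_letters_pow hK n).isClosed) (fun _ _ h => letters_pow_mono _ h)
    (fun u _ => exists_mem_letters_pow _ hKtop' u)
  -- The radius must cover the relators of `G` and contain generators of the compact stabiliser.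
  obtain ⟨N, hnN, hmN, h1N⟩ : ∃ N, n ≤ N ∧ m ≤ N ∧ 1 ≤ N :=
    ⟨n + m + 1, by omega, by omega, by omega⟩
  have hV := translators_image_stabilizer_mul (H := schlichtingCompletion Λ)
    (QuotientGroup.mk 1 : Γ ⧸ Λ) (letters ((↑) : K → schlichtingCompletion Λ) ^ N)
  have hsymm := inv_mem_stabilizer_mul (H := schlichtingCompletion Λ)
    (QuotientGroup.mk 1 : Γ ⧸ Λ) (letters_pow_inv ((↑) : K → schlichtingCompletion Λ) N)
  have ho := mem_image_stabilizer_mul (H := schlichtingCompletion Λ)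
    (QuotientGroup.mk 1 : Γ ⧸ Λ) (one_mem_letters_pow ((↑) : K → schlichtingCompletion Λ) N)
  have hY := image_smul_finite_of_isCompact _ ((hU.mul (isCompact_letters_pow hK N)).mul hU)
    (QuotientGroup.mk 1 : Γ ⧸ Λ)
  rw [← hV] at hsymm
  have hbij := toAmbient_bijective_of_presentation ((↑) : K → schlichtingCompletion Λ)
    (MulAction.stabilizer (schlichtingCompletion Λ) (QuotientGroup.mk 1 : Γ ⧸ Λ)) hKtop' R
    (fun r hr => (hR r hr).imp fun w hw => ⟨hw.1.trans hnN, hw.2⟩) hker h1N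
    (hm.trans (Subgroup.closure_mono (Set.inter_subset_inter_right _ (letters_pow_mono _ hmN)))) hV
  have hbij' := toAmbient_translators_bijective_of_dense' (toSchlichtingCompletion Λ)
    (toSchlichtingCompletion_smul Λ) (schlichtingCompletion_dense Λ) ho hsymm hbij
  exact Group.IsFinitelyPresented.of_toAmbient_translators_bijective Λ smul_mk_one_eq_iff hY ho
    (fun y _ => MulAction.exists_smul_eq Γ _ y)
    (translators_inv_mem_of_dense (toSchlichtingCompletion Λ) (toSchlichtingCompletion_smul Λ) hsymm)
    hbij'

theorem isCompactlyGenerated_schlichtingCompletion_of_fg (hΛ : Λ.IsCommensurated)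
    (hfg : Group.FG Γ) : IsCompactlyGeneratedGroup (schlichtingCompletion Λ) := by
  obtain ⟨S, hS, hSfin⟩ := Group.fg_iff.1 hfg
  refine ⟨toSchlichtingCompletion Λ '' S ∪ MulAction.stabilizer (schlichtingCompletion Λ)
    (QuotientGroup.mk 1 : Γ ⧸ Λ), (hSfin.image _).isCompact.union (isCompact_stabilizer hΛ), ?_⟩
  rw [eq_top_iff]
  intro g _
  obtain ⟨γ, u, hu, rfl, -⟩ := exists_mul_of_dense (o := (QuotientGroup.mk 1 : Γ ⧸ Λ))
    (toSchlichtingCompletion Λ) (toSchlichtingCompletion_smul Λ) (schlichtingCompletion_dense Λ) g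
  refine Subgroup.mul_mem _ ?_ (Subgroup.subset_closure (Or.inr hu))
  refine Subgroup.closure_mono Set.subset_union_left ?_
  rw [← MonoidHom.map_closure, hS]
  exact ⟨γ, trivial, rfl⟩

theorem isCompactlyPresented_schlichtingCompletion_of_isFinitelyPresented
    (hΛ : Λ.IsCommensurated) (hΓ : Group.IsFinitelyPresented Γ) (hfg : Group.FG Λ) :
    IsCompactlyPresentedGroup (schlichtingCompletion Λ) := by
  obtain ⟨n, φ, hφ, R, hRfin, hker⟩ := hΓ.out
  obtain ⟨T, hT, hTfin⟩ := (Subgroup.fg_iff Λ).1 ((Group.fg_iff_subgroup_fg Λ).1 hfg)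
  let f : Fin n → Γ := fun i => φ (FreeGroup.of i)
  have hf : FreeGroup.lift f = φ := FreeGroup.ext_hom _ _ fun i => by simp [f]
  have hftop : Subgroup.closure (Set.range f) = ⊤ := by
    rw [← FreeGroup.range_lift_eq_closure, hf, MonoidHom.range_eq_top.2 hφ]
  choose k hk using exists_mem_letters_pow f hftop
  obtain ⟨N₁, hN₁⟩ := (hRfin.image fun r => r.toWord.length).bddAbove
  obtain ⟨N₂, hN₂⟩ := (hTfin.image k).bddAbove
  -- The radius must cover the relators of `Γ` and contain the generators `T` of `Λ`.
  obtain ⟨N, h1, h2, h1N⟩ : ∃ N, N₁ ≤ N ∧ N₂ ≤ N ∧ 1 ≤ N :=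
    ⟨N₁ + N₂ + 1, by omega, by omega, by omega⟩
  have hW := translators_image_stabilizer_mul (H := Γ)
    (QuotientGroup.mk 1 : Γ ⧸ Λ) (letters f ^ N)
  have hsymm := inv_mem_stabilizer_mul (H := Γ)
    (QuotientGroup.mk 1 : Γ ⧸ Λ) (letters_pow_inv f N)
  have ho := mem_image_stabilizer_mul (H := Γ)
    (QuotientGroup.mk 1 : Γ ⧸ Λ) (one_mem_letters_pow f N)
  rw [← hW] at hsymm
  have hT' : T ⊆ Λ := hT ▸ Subgroup.subset_closure
  have hbij := toAmbient_bijective_of_presentation f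
    (MulAction.stabilizer Γ (QuotientGroup.mk 1 : Γ ⧸ Λ)) hftop R
    (fun r hr => ⟨r.toWord, (hN₁ ⟨r, hr, rfl⟩).trans h1, FreeGroup.mk_toWord⟩)
    (by rw [hker, hf]) h1N (by
      rw [stabilizer_mk_one]
      nth_rw 1 [← hT]
      exact Subgroup.closure_mono fun t ht =>
        ⟨hT' ht, letters_pow_mono f ((hN₂ ⟨t, ht, rfl⟩).trans h2) (hk t)⟩) hW
  have hbij' := toAmbient_translators_bijective_of_dense (toSchlichtingCompletion Λ)
    (toSchlichtingCompletion_smul Λ) (schlichtingCompletion_dense Λ) ho hsymm hbij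
  refine isCompactlyPresentedGroup_of_toAmbient_bijective
    (isCompact_translators hΛ ?_ ?_) hbij'
  · have hB : (letters f ^ N).Finite := by
      clear h1 h2 h1N hW hsymm ho hbij hbij'
      induction N with
      | zero => simp
      | succ N ih =>
        rw [pow_succ]
        exact ih.mul
          (((Set.finite_range f).union (Set.finite_range f).inv).union (Set.finite_singleton _))
    -- The cosets involved lie in the `Λ`-orbits of `b • o` for `b` in a finite ball.
    refine (hB.biUnion fun b _ => hΛ.orbit_finite (b • (QuotientGroup.mk 1 : Γ ⧸ Λ))).subset ?_
    rintro _ ⟨_, ⟨_, ⟨l, hl, b, hb, rfl⟩, l', hl', rfl⟩, rfl⟩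
    rw [stabilizer_mk_one] at hl
    have hl'' : l' • (QuotientGroup.mk 1 : Γ ⧸ Λ) = QuotientGroup.mk 1 := hl'
    refine Set.mem_biUnion hb ⟨⟨l, hl⟩, ?_⟩
    change l • b • (QuotientGroup.mk 1 : Γ ⧸ Λ) = (l * b * l') • (QuotientGroup.mk 1 : Γ ⧸ Λ)
    rw [mul_smul, mul_smul, hl'']
  · exact translators_inv_mem_of_dense' (schlichtingCompletion_dense Λ) hsymm

end Schlichting

theorem mainTheorem6 {Γ : Type*} [Group Γ] (Λ : Subgroup Γ) (hΛ : Λ.IsCommensurated) :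
    (IsCompactlyGeneratedGroup (schlichtingCompletion Λ) → Group.FG Λ → Group.FG Γ) ∧
    (IsCompactlyPresentedGroup (schlichtingCompletion Λ) → Group.IsFinitelyPresented Λ →
      Group.IsFinitelyPresented Γ) ∧
    (Group.FG Γ → IsCompactlyGeneratedGroup (schlichtingCompletion Λ)) ∧
    (Group.IsFinitelyPresented Γ → Group.FG Λ →
      IsCompactlyPresentedGroup (schlichtingCompletion Λ)) :=
  ⟨fg_of_isCompactlyGenerated_schlichtingCompletion hΛ,
    isFinitelyPresented_of_isCompactlyPresented_schlichtingCompletion hΛ,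
    isCompactlyGenerated_schlichtingCompletion_of_fg hΛ,
    isCompactlyPresented_schlichtingCompletion_of_isFinitelyPresented hΛ⟩
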